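/- All systems are finite-dimensional. A quantum channel is a completely positive trace-preserving linear map, and the min-entropy of a state $\rho$ is $S_{\min}(\rho)=-\log_2\|\rho\|$ with $\|\cdot\|$ the operator norm. Let $d\ge 1$, let $S=\mathbb C^d$, and let $|\Psi\rangle_{AB}\in\mathcal H_A\otimes\mathcal H_B$ be a unit vector with marginal $\Psi_A=\mathrm{Tr}_B|\Psi\rangle\langle\Psi|$. We say that $|\Psi\rangle_{AB}$ can be used as a quantum one-time pad for faithful one-shot private transfer of a $d$-dimensional quantum state if there are a finite-dimensional system $A'$ (the system that Alice transmits) and a family of quantum channels $\Phi_\psi:\mathcal B(\mathcal H_A)\to\mathcal B(\mathcal H_{A'})$, indexed by the density matrices $\psi$ on $S$, such that 1. the family results from an interaction of the (possibly unknown) state $\psi$ with Alice's system: there is one quantum channel $\mathcal E:\mathcal B(\mathcal H_S\otimes\mathcal H_A)\to\mathcal B(\mathcal H_{A'})$ with $\Phi_\psi(X)=\mathcal E(\psi\otimes X)$ for all $\psi$ and all $X$; 2. (privacy) $\Phi_\psi(\Psi_A)$ is the same operator for all $\psi$; 3. (faithful recovery) there are a finite-dimensional system $E$ and a unitary $M:\mathcal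 H_S\otimes\mathcal H_E\to\mathcal H_{A'}\otimes\mathcal H_B$, independent of $\psi$, with $\mathrm{Tr}_E\big(M^\dagger(\Phi_\psi\otimes\mathcal I_B)(|\Psi\rangle\langle\Psi|)M\big)=\psi$ for all $\psi$. **Theorem.** The state $|\Psi\rangle_{AB}$ can be used as a quantum one-time pad for faithful one-shot private transfer of a $d$-dimensional quantum state if and only if $S_{\min}(\Psi_A)\ge\log_2 d$. -/

import Mathlib

open scoped Matrix Kronecker ComplexOrder

noncomputable section

namespace QOTP

/-- Partial trace over the second tensor factor. -/
def ptraceRight {m n : Type*} [Fintype n] (X : Matrix (m × n) (m × n) ℂ) : Matrix m m ℂ :=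
  fun i j => ∑ k, X (i, k) (j, k)

/-- A density matrix (quantum state): positive semidefinite with unit trace. -/
def IsDensity {m : Type*} [Fintype m] (ρ : Matrix m m ℂ) : Prop :=
  ρ.PosSemidef ∧ ρ.trace = 1

/-- The quantum states of the `d`-dimensional system `ℂ^d`. -/
abbrev State (d : ℕ) : Type := {ρ : Matrix (Fin d) (Fin d) ℂ // IsDensity ρ}

/-- The map `Φ ⊗ id` : apply `Φ` to the first tensor factor and nothing to the second. -/
def onFirst {m n : Type*} (Φ : Matrix m m ℂ →ₗ[ℂ] Matrix n n ℂ) {r : Type*}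
    (X : Matrix (m × r) (m × r) ℂ) : Matrix (n × r) (n × r) ℂ :=
  fun p q => Φ (fun i j => X (i, p.2) (j, q.2)) p.1 q.1

/-- A quantum channel: a completely positive trace preserving linear map. -/
structure IsChannel {m n : Type*} [Fintype m] [Fintype n]
    (Φ : Matrix m m ℂ →ₗ[ℂ] Matrix n n ℂ) : Prop where
  completely_positive : ∀ (k : ℕ) (X : Matrix (m × Fin k) (m × Fin k) ℂ),
    X.PosSemidef → (onFirst Φ X).PosSemidef
  trace_preserving : ∀ X : Matrix m m ℂ, (Φ X).trace = X.trace

/-- The rank one operator `|Ψ⟩⟨Ψ|`. -/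
def dyad {m : Type*} (Ψ : EuclideanSpace ℂ m) : Matrix m m ℂ :=
  fun p q => Ψ p * star (Ψ q)

/-- The marginal state `Ψ_A` of the bipartite vector `|Ψ⟩_AB`. -/
def marginalA {a b : Type*} [Fintype b] (Ψ : EuclideanSpace ℂ (a × b)) : Matrix a a ℂ :=
  ptraceRight (dyad Ψ)

/-- The min-entropy `S_min(ρ) = -log₂ ‖ρ‖`, with the operator norm on the Euclidean space. -/
def minEntropy {m : Type*} [Fintype m] [DecidableEq m] (ρ : Matrix m m ℂ) : ℝ :=
  -Real.logb 2 ‖Matrix.toEuclideanCLM (n := m) (𝕜 := ℂ) ρ‖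

/-- The family of channels `Φ ψ`, indexed by the states `ψ` of a `d`-dimensional system `S` and
acting from Alice's system `A` to the transmitted system `A'`, encodes `ψ` into `|Ψ⟩_AB` for
`d`-dimensional faithful one-shot private state transfer. -/
structure IsPST {a b a' : Type*} [Fintype a] [DecidableEq a] [Fintype b] [DecidableEq b]
    [Fintype a'] [DecidableEq a'] (d : ℕ) (Ψ : EuclideanSpace ℂ (a × b))
    (Φ : State d → (Matrix a a ℂ →ₗ[ℂ] Matrix a' a' ℂ)) : Prop where
  /-- every member of the family is a quantum channel -/
  channel : ∀ ψ, IsChannel (Φ ψ)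
  /-- `Φ ψ` results from a physical interaction, the same for all (possibly unknown) `ψ`, of the
  system `S` in the state `ψ` with Alice's system `A` -/
  interaction : ∃ E : Matrix (Fin d × a) (Fin d × a) ℂ →ₗ[ℂ] Matrix a' a' ℂ,
    IsChannel E ∧ ∀ (ψ : State d) (X : Matrix a a ℂ), Φ ψ X = E (ψ.1 ⊗ₖ X)
  /-- privacy: the transmitted state does not depend on `ψ` -/
  secrecy : ∃ σ : Matrix a' a' ℂ, ∀ ψ, Φ ψ (marginalA Ψ) = σ
  /-- faithful recovery: a unitary `M : S ⊗ E → A' ⊗ B`, the same for all `ψ`, such that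
  `Tr_E (M† (Φ_ψ ⊗ id_B)(|Ψ⟩⟨Ψ|) M) = ψ` -/
  recovery : ∃ (k : ℕ) (M : Matrix (a' × b) (Fin d × Fin k) ℂ),
    Mᴴ * M = 1 ∧ M * Mᴴ = 1 ∧
      ∀ ψ : State d, ptraceRight (Mᴴ * onFirst (Φ ψ) (dyad Ψ) * M) = ψ.1

/-- `|Ψ⟩_AB` can be used as a quantum one-time pad for faithful one-shot private transfer of a
`d`-dimensional quantum state: some finite-dimensional transmitted system and some encoding
family do it. -/
def IsOneTimePad {a b : Type*} [Fintype a] [DecidableEq a] [Fintype b] [DecidableEq b]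
    (d : ℕ) (Ψ : EuclideanSpace ℂ (a × b)) : Prop :=
  ∃ (n : ℕ) (Φ : State d → (Matrix a a ℂ →ₗ[ℂ] Matrix (Fin n) (Fin n) ℂ)), IsPST d Ψ Φ

end QOTP

end

/-! Let `C = coeff Ψ`, so that `Ψ_A = C Cᴴ` and `‖Ψ_A‖ = ‖C‖²`. The entropy condition then says `d
‖C v‖² ≤ ‖v‖²` for every vector `v` on Bob's side (`logb_le_minEntropy_iff`), and both directions
work with this inequality.

Necessity (`IsOneTimePad.le`). Since states span all operators, secrecy and recovery extend linearly
from states to the matrix units of `S`. Applying the interaction to half of a maximally entangled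
pair together with `Ψ`, and purifying the output by an index `e`, gives vectors `G e x`
(`IsChannel.exists_code`). Faithful recovery forces `G e x = M (x ⊗ g e)` with `g` independent of
`x` (`exists_common_vector`), while secrecy says that `A'` decouples from the input. A
Cauchy–Schwarz type estimate, `sum_component_le`, bounds the total weight of this code along `v` by
`‖v‖²`. Each of the `d` inputs contributes `‖C v‖²`, because Alice's channel cannot change Bob's
marginal.

Sufficiency (`isOneTimePad_of_le`) is teleportation with a randomly chosen maximally entangled
block. The squared Schmidt coefficients `p` are at most `1 / d`, so by Birkhoff's theorem `p` is a
mixture of uniform distributions on `d` points (`exists_perm_mixture`). Alice measures `S ⊗ A` with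
outcomes consisting of a shift, a phase and a permutation, and sends the outcome. Its distribution
does not depend on the input, and for each outcome Bob holds an isometric image of the input, which
a controlled unitary undoes. -/

namespace QOTP

open Matrix

/-! ### The entropy condition as an operator inequality. -/

section Marginal

variable {a b : Type*}

/-- The matrix of coefficients of a bipartite vector. -/
def coeff (Ψ : EuclideanSpace ℂ (a × b)) : Matrix a b ℂ := Matrix.of fun i j => Ψ (i, j)

@[simp] lemma coeff_apply (Ψ : EuclideanSpace ℂ (a × b)) (i : a) (j : b) :
    coeff Ψ i j = Ψ (i, j) := rfl

lemma marginalA_eq [Fintype b] (Ψ : EuclideanSpace ℂ (a × b)) :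
    marginalA Ψ = coeff Ψ * (coeff Ψ)ᴴ := by
  ext i j
  simp [marginalA, ptraceRight, dyad, Matrix.mul_apply]

lemma trace_coeff [Fintype a] [Fintype b] (Ψ : EuclideanSpace ℂ (a × b)) :
    ((coeff Ψ)ᴴ * coeff Ψ).trace = ((‖Ψ‖ ^ 2 : ℝ) : ℂ) := by
  rw [EuclideanSpace.norm_sq_eq, Fintype.sum_prod_type, Finset.sum_comm]
  simp only [trace, diag_apply, mul_apply, conjTranspose_apply, coeff_apply, Complex.ofReal_sum]
  refine Finset.sum_congr rfl fun j _ => Finset.sum_congr rfl fun i _ => ?_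
  rw [Complex.ofReal_pow]
  exact Complex.conj_mul' _

open scoped Matrix.Norms.L2Operator in
lemma norm_le_iff_forall_mulVec {m n : Type*} [Fintype m] [Fintype n] [DecidableEq n]
    (C : Matrix m n ℂ) {r : ℝ} (hr : 0 ≤ r) :
    ‖C‖ ≤ r ↔ ∀ v : n → ℂ, ∑ i, ‖(C *ᵥ v) i‖ ^ 2 ≤ r ^ 2 * ∑ j, ‖v j‖ ^ 2 := by
  have key : ∀ v : n → ℂ,
      (∑ i, ‖(C *ᵥ v) i‖ ^ 2 ≤ r ^ 2 * ∑ j, ‖v j‖ ^ 2 ↔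
        ‖WithLp.toLp 2 (C *ᵥ v)‖ ≤ r * ‖WithLp.toLp 2 v‖) := by
    intro v
    rw [← sq_le_sq₀ (norm_nonneg _) (by positivity), mul_pow, EuclideanSpace.norm_sq_eq,
      EuclideanSpace.norm_sq_eq]
  simp_rw [key]
  constructor
  · intro h v
    exact (l2_opNorm_mulVec C (WithLp.toLp 2 v)).trans (by gcongr)
  · intro h
    rw [l2_opNorm_def]
    exact ContinuousLinearMap.opNorm_le_bound _ hr fun x => h x.ofLp

-- The C*-identity turns the norm of the marginal into `‖coeff Ψ‖ ^ 2`. Normalization of `Ψ` makes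
-- this positive, so the logarithms can be compared through their arguments.
open scoped Matrix.Norms.L2Operator in
lemma logb_le_minEntropy_iff [Fintype a] [DecidableEq a] [Fintype b] [DecidableEq b]
    {d : ℕ} (hd : 1 ≤ d) (Ψ : EuclideanSpace ℂ (a × b)) (hΨ : ‖Ψ‖ = 1) :
    Real.logb 2 (d : ℝ) ≤ minEntropy (marginalA Ψ) ↔
      ∀ v : b → ℂ, d * ∑ i, ‖(coeff Ψ *ᵥ v) i‖ ^ 2 ≤ ∑ j, ‖v j‖ ^ 2 := by
  have hd' : (0 : ℝ) < d := by exact_mod_cast hd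
  have hC : coeff Ψ ≠ 0 := by
    intro h
    have := trace_coeff Ψ
    simp [h, hΨ] at this
  have hn : ‖Matrix.toEuclideanCLM (n := a) (𝕜 := ℂ) (marginalA Ψ)‖ = ‖coeff Ψ‖ ^ 2 := by
    rw [l2_opNorm_toEuclideanCLM, marginalA_eq, sq]
    have := l2_opNorm_conjTranspose_mul_self (coeff Ψ)ᴴ
    rwa [conjTranspose_conjTranspose, l2_opNorm_conjTranspose] at this
  have hpos : 0 < ‖coeff Ψ‖ ^ 2 := by
    have : 0 < ‖coeff Ψ‖ := norm_pos_iff.2 hC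
    positivity
  rw [minEntropy, hn, ← Real.logb_inv, Real.logb_le_logb (by norm_num) hd' (by positivity),
    le_inv_comm₀ hd' hpos]
  have h2 : ‖coeff Ψ‖ ^ 2 ≤ (d : ℝ)⁻¹ ↔ ‖coeff Ψ‖ ≤ √((d : ℝ)⁻¹) := by
    rw [Real.le_sqrt' (norm_pos_iff.2 hC)]
  rw [h2, norm_le_iff_forall_mulVec _ (Real.sqrt_nonneg _), Real.sq_sqrt (by positivity)]
  refine forall_congr' fun v => ?_
  rw [le_inv_mul_iff₀ hd']

end Marginal

/-! ### Extending identities from states to all operators. -/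

section Span

lemma isDensity_smul_vecMulVec {m : Type*} [Fintype m] {u : m → ℂ} (hu : u ≠ 0) :
    IsDensity (((∑ i, ‖u i‖ ^ 2 : ℝ) : ℂ)⁻¹ • vecMulVec u (star u)) := by
  obtain ⟨i, hi⟩ := Function.ne_iff.1 hu
  have hpos : 0 < ∑ i, ‖u i‖ ^ 2 :=
    Finset.sum_pos' (fun _ _ => by positivity)
      ⟨i, Finset.mem_univ _, by have : 0 < ‖u i‖ := norm_pos_iff.2 hi
                                positivity⟩
  refine ⟨(posSemidef_vecMulVec_self_star u).smul ?_, ?_⟩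
  · rw [← Complex.ofReal_inv]
    exact_mod_cast (inv_pos.2 hpos).le
  · have : (vecMulVec u (star u)).trace = ((∑ i, ‖u i‖ ^ 2 : ℝ) : ℂ) := by
      simp [trace, vecMulVec_apply, Complex.mul_conj']
    rw [trace_smul, this, smul_eq_mul, inv_mul_cancel₀]
    exact_mod_cast hpos.ne'

/-- The states of a quantum system span its operators. -/
lemma linearMap_ext_state {d : ℕ} {V : Type*} [AddCommGroup V] [Module ℂ V]
    {f g : Matrix (Fin d) (Fin d) ℂ →ₗ[ℂ] V} (h : ∀ ψ : State d, f ψ.1 = g ψ.1) : f = g := by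
  have h1 : ∀ u : Fin d → ℂ, f (vecMulVec u (star u)) = g (vecMulVec u (star u)) := by
    intro u
    by_cases hu : u = 0
    · simp [hu]
    · have h2 := h ⟨_, isDensity_smul_vecMulVec hu⟩
      have h3 : ((∑ i, ‖u i‖ ^ 2 : ℝ) : ℂ)⁻¹ ≠ 0 := by
        intro h0
        have := (isDensity_smul_vecMulVec hu).2
        rw [h0, zero_smul, trace_zero] at this
        exact zero_ne_one this
      simp only [map_smul] at h2
      exact smul_right_injective V h3 h2
  have polar : ∀ u v : Fin d → ℂ, vecMulVec u (star v) = (1 / 4 : ℂ) •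
      (vecMulVec (u + v) (star (u + v)) - vecMulVec (u - v) (star (u - v))
        + Complex.I • vecMulVec (u + Complex.I • v) (star (u + Complex.I • v))
        - Complex.I • vecMulVec (u - Complex.I • v) (star (u - Complex.I • v))) := by
    intro u v
    ext i j
    simp only [vecMulVec_apply, Matrix.smul_apply, Matrix.add_apply, Matrix.sub_apply,
      Pi.star_apply, Pi.add_apply, Pi.sub_apply, Pi.smul_apply, smul_eq_mul, star_add, star_sub,
      star_mul', Complex.star_def,
      Complex.conj_I]
    ring_nf
    rw [Complex.I_sq]
    ring
  refine Matrix.ext_linearMap ℂ fun i j => LinearMap.ext_ring ?_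
  have h3 : Matrix.single i j (1 : ℂ)
      = vecMulVec (Pi.single i 1) (star (Pi.single j 1 : Fin d → ℂ)) := by
    rw [Matrix.single_eq_single_vecMulVec_single, ← Pi.single_star, star_one]
  simp only [LinearMap.comp_apply, singleLinearMap_apply, h3]
  rw [polar]
  simp only [map_smul, map_add, map_sub, h1]

end Span

/-! ### The estimate that combines secrecy with recovery. -/

section Decoupling

variable {m n b d k : Type*} [Fintype m] [Fintype n] [Fintype b] [Fintype d] [Fintype k]
  [DecidableEq n] [DecidableEq b] [DecidableEq d]

/-- If an isometric code `x ↦ M (x ⊗ g)` hides `x` from the first tensor factor, then the component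
of the code along a vector `v` of the second factor is bounded. -/
lemma sum_component_le (M : Matrix (n × b) (d × k) ℂ) (hM : M * Mᴴ = 1)
    (g : m → k → ℂ) (hg : ∑ e, ∑ κ, ‖g e κ‖ ^ 2 = 1) (σ : Matrix n n ℂ) (hσ : σ.trace = 1)
    (G : m → d → n × b → ℂ) (hG : ∀ e x p, G e x p = ∑ κ, M p (x, κ) * g e κ)
    (hsec : ∀ x y α α', ∑ e, ∑ β, G e x (α, β) * star (G e y (α', β))
      = if x = y then σ α α' else 0) (v : b → ℂ) :
    ∑ x, ∑ e, ∑ α, ‖∑ β, v β * G e x (α, β)‖ ^ 2 ≤ ∑ β, ‖v β‖ ^ 2 := by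
  set χ : m → d → n → ℂ := fun e x α => ∑ β, v β * G e x (α, β) with hχ
  -- `Gt * N` and `V` both have squared Hilbert–Schmidt norm `r`, and their overlap is `l`. Hence
  -- `‖Gt * N - V‖² = 2 r - 2 l`, and its nonnegativity is the claim. Secrecy enters through `Gtᴴ *
  -- Gt = σ ⊗ 1`, unitarity through `M * Mᴴ = 1`.
  let Gt : Matrix (m × b) (n × d) ℂ := of fun p q => star (G p.1 q.2 (q.1, p.2))
  let N : Matrix (n × d) k ℂ := of fun q κ => ∑ β, v β * M (q.1, β) (q.2, κ)
  let V : Matrix (m × b) k ℂ := of fun p κ => v p.2 * star (g p.1 κ)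
  set r : ℝ := ∑ β, ‖v β‖ ^ 2 with hr
  set l : ℝ := ∑ x, ∑ e, ∑ α, ‖χ e x α‖ ^ 2 with hl
  have hGt : Gtᴴ * Gt = σ ⊗ₖ (1 : Matrix d d ℂ) := by
    ext ⟨α, x⟩ ⟨α', y⟩
    simp only [Gt, mul_apply, conjTranspose_apply, of_apply, star_star, Fintype.sum_prod_type,
      hsec, kroneckerMap_apply, one_apply, mul_ite, mul_one, mul_zero]
  have hMM : ∀ α α', ∑ x, ∑ κ, N (α, x) κ * star (N (α', x) κ)
      = if α = α' then (r : ℂ) else 0 := by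
    intro α α'
    have h1 : ∀ β β', ∑ x, ∑ κ, M (α, β) (x, κ) * star (M (α', β') (x, κ))
        = if α = α' ∧ β = β' then 1 else 0 := by
      intro β β'
      have := congrFun (congrFun hM (α, β)) (α', β')
      simpa [mul_apply, Fintype.sum_prod_type, one_apply] using this
    have h2 : ∑ x, ∑ κ, N (α, x) κ * star (N (α', x) κ) = ∑ β, ∑ β', (v β * star (v β')) *
        ∑ x, ∑ κ, M (α, β) (x, κ) * star (M (α', β') (x, κ)) := by
      calc ∑ x, ∑ κ, N (α, x) κ * star (N (α', x) κ)
          = ∑ q : d × k, ∑ p : b × b, (v p.1 * star (v p.2)) *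
              (M (α, p.1) q * star (M (α', p.2) q)) := by
            simp only [N, of_apply, star_sum, Finset.sum_mul_sum, Fintype.sum_prod_type]
            refine Finset.sum_congr rfl fun x _ => Finset.sum_congr rfl fun κ _ =>
              Finset.sum_congr rfl fun β _ => Finset.sum_congr rfl fun β' _ => ?_
            simp only [star_mul']
            ring
        _ = _ := by
            rw [Finset.sum_comm]
            simp only [Finset.mul_sum, Fintype.sum_prod_type]
    rw [h2]
    simp_rw [h1]
    by_cases h : α = α'
    · simp [h, hr, Complex.mul_conj']
    · simp [h]
  have hWW : ((Gt * N)ᴴ * (Gt * N)).trace = r := by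
    rw [conjTranspose_mul, Matrix.mul_assoc, ← Matrix.mul_assoc Gtᴴ, hGt, trace_mul_comm,
      Matrix.mul_assoc]
    have : (σ ⊗ₖ (1 : Matrix d d ℂ) * (N * Nᴴ)).trace
        = ∑ α, ∑ α', σ α α' * ∑ x, ∑ κ, N (α', x) κ * star (N (α, x) κ) := by
      simp only [trace, diag_apply, mul_apply, conjTranspose_apply, Fintype.sum_prod_type,
        kroneckerMap_apply, one_apply, mul_ite, mul_one, mul_zero, ite_mul, zero_mul,
        Finset.mul_sum]
      refine Finset.sum_congr rfl fun α _ => ?_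
      rw [Finset.sum_comm]
      refine Finset.sum_congr rfl fun α' _ => Finset.sum_congr rfl fun x _ => ?_
      rw [Finset.sum_comm]
      simp
    rw [this]
    simp_rw [hMM]
    have h2 : ∑ α, σ α α = 1 := hσ
    simp [← Finset.sum_mul, h2]
  have hVV : (Vᴴ * V).trace = r := by
    have : (Vᴴ * V).trace = ((∑ e, ∑ κ, ‖g e κ‖ ^ 2 : ℝ) : ℂ) * ((r : ℝ) : ℂ) := by
      simp only [trace, diag_apply, mul_apply, conjTranspose_apply, V, of_apply,
        Fintype.sum_prod_type, hr, Complex.ofReal_sum, Complex.ofReal_pow, star_mul', star_star,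
        Finset.sum_mul, Finset.mul_sum, ← Complex.mul_conj']
      rw [Finset.sum_comm]
      symm
      rw [Finset.sum_comm]
      refine Finset.sum_congr rfl fun e _ => ?_
      rw [Finset.sum_comm]
      refine Finset.sum_congr rfl fun κ _ => Finset.sum_congr rfl fun β _ => ?_
      simp only [Complex.star_def]
      ring
    rw [this, hg, Complex.ofReal_one, one_mul]
  have hVW : (Vᴴ * (Gt * N)).trace = l := by
    rw [← Matrix.mul_assoc, trace_mul_comm, ← Matrix.mul_assoc]
    have h1 : ∀ q p, (N * Vᴴ) q p = star (v p.2) * χ p.1 q.2 q.1 := by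
      rintro ⟨α, x⟩ ⟨e, β⟩
      simp only [mul_apply, N, V, of_apply, conjTranspose_apply, star_mul', star_star, hχ, hG,
        Finset.sum_mul, Finset.mul_sum]
      rw [Finset.sum_comm]
      refine Finset.sum_congr rfl fun β' _ => Finset.sum_congr rfl fun κ _ => ?_
      ring
    simp only [trace, diag_apply, mul_apply (M := N * Vᴴ), h1, Fintype.sum_prod_type, Gt, of_apply,
      hl, Complex.ofReal_sum, Complex.ofReal_pow, ← Complex.mul_conj']
    rw [Finset.sum_comm]
    refine Finset.sum_congr rfl fun x _ => ?_
    rw [Finset.sum_comm]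
    refine Finset.sum_congr rfl fun e _ => Finset.sum_congr rfl fun α _ => ?_
    conv_rhs => rw [hχ]
    simp only [map_sum, map_mul, Finset.mul_sum]
    refine Finset.sum_congr rfl fun β _ => ?_
    simp only [Complex.star_def]
    ring
  have hWV : ((Gt * N)ᴴ * V).trace = l := by
    have := congrArg star hVW
    rw [← trace_conjTranspose, conjTranspose_mul, conjTranspose_conjTranspose] at this
    simpa using this
  have hpos : 0 ≤ ((Gt * N - V)ᴴ * (Gt * N - V)).trace :=
    (posSemidef_conjTranspose_mul_self _).trace_nonneg
  rw [conjTranspose_sub, Matrix.sub_mul, Matrix.mul_sub, Matrix.mul_sub, trace_sub, trace_sub,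
    trace_sub, hWW, hVV, hVW, hWV] at hpos
  have : (0 : ℝ) ≤ r - l - (l - r) := by exact_mod_cast hpos
  linarith

end Decoupling

/-! ### A one-time pad forces the entropy bound. -/

section Necessity

/-- The block of `|Ψ⟩⟨Ψ|` with indices `β`, `β'` in the second factor. -/
def dyadBlock {a b : Type*} (Ψ : EuclideanSpace ℂ (a × b)) (β β' : b) : Matrix a a ℂ :=
  fun i j => dyad Ψ (i, β) (j, β')

lemma marginalA_eq_sum_dyadBlock {a b : Type*} [Fintype b] (Ψ : EuclideanSpace ℂ (a × b)) :
    marginalA Ψ = ∑ β, dyadBlock Ψ β β := by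
  ext i j
  simp [marginalA, ptraceRight, dyadBlock, Matrix.sum_apply]

/-- A channel sends half of a maximally entangled state, together with half of `Ψ`, to a positive
operator, which is a sum of rank one operators. -/
lemma IsChannel.exists_code {a b n d : Type*} [Fintype a] [Fintype b] [Fintype n] [Fintype d]
    [DecidableEq d] {E : Matrix (d × a) (d × a) ℂ →ₗ[ℂ] Matrix n n ℂ} (hE : IsChannel E)
    (Ψ : EuclideanSpace ℂ (a × b)) :
    ∃ (m : ℕ) (G : Fin m → d → n × b → ℂ), ∀ x y p q,
      E (single x y 1 ⊗ₖ dyadBlock Ψ p.2 q.2) p.1 q.1 = ∑ e, G e x p * star (G e y q) := by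
  let f := Fintype.equivFin (d × b)
  -- The unnormalized maximally entangled vector on `S` and a copy of `S`, tensored with `Ψ`. The
  -- copy and Bob's system together form the reference, flattened to a `Fin` as `IsChannel` demands.
  let w : (d × a) × Fin (Fintype.card (d × b)) → ℂ := fun p =>
    if (f.symm p.2).1 = p.1.1 then Ψ (p.1.2, (f.symm p.2).2) else 0
  have h1 := hE.completely_positive _ _ (posSemidef_vecMulVec_self_star w)
  obtain ⟨m, v, hv⟩ := Matrix.posSemidef_iff_eq_sum_vecMulVec.1 h1
  refine ⟨m, fun e x p => v e (p.1, f (x, p.2)), fun x y p q => ?_⟩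
  have h2 := congrFun (congrFun hv (p.1, f (x, p.2))) (q.1, f (y, q.2))
  rw [Matrix.sum_apply] at h2
  simp only [vecMulVec_apply, Pi.star_apply] at h2
  rw [← h2]
  simp only [onFirst, vecMulVec_apply, Pi.star_apply]
  refine congrFun (congrFun (congrArg E ?_) _) _
  ext ⟨s, i⟩ ⟨t, j⟩
  simp only [kroneckerMap_apply, single_apply, dyadBlock, dyad, w, Equiv.symm_apply_apply]
  by_cases hx : x = s <;> by_cases hy : y = t <;> simp [hx, hy]

/-- Regard each block `H · x (s, ·)` as a vector indexed by `e` and `κ`. The hypothesis lists the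
inner products of these blocks: those with `x ≠ s` have norm zero, and the diagonal ones are unit
vectors with pairwise inner product one, hence equal. -/
lemma exists_common_vector {m d k : Type*} [Fintype m] [Fintype k] [DecidableEq d]
    [Nonempty d] (H : m → d → d × k → ℂ)
    (hH : ∀ x y s t, ∑ κ, ∑ e, H e x (s, κ) * star (H e y (t, κ))
      = if x = s ∧ y = t then 1 else 0) :
    ∃ g : m → k → ℂ, (∀ e x s κ, H e x (s, κ) = if x = s then g e κ else 0) ∧
      ∑ e, ∑ κ, ‖g e κ‖ ^ 2 = 1 := by
  have x₀ : d := Classical.arbitrary d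
  have vanish : ∀ F : k → m → ℂ, ∑ κ, ∑ e, F κ e * star (F κ e) = 0 → ∀ κ e, F κ e = 0 := by
    intro F hF κ e
    have h1 : ((∑ κ, ∑ e, ‖F κ e‖ ^ 2 : ℝ) : ℂ) = 0 := by
      rw [← hF]
      push_cast
      simp only [← Complex.mul_conj', Complex.star_def]
    rw [Complex.ofReal_eq_zero, Finset.sum_eq_zero_iff_of_nonneg
      fun _ _ => Finset.sum_nonneg fun _ _ => by positivity] at h1
    have h2 := h1 κ (Finset.mem_univ _)
    rw [Finset.sum_eq_zero_iff_of_nonneg fun _ _ => by positivity] at h2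
    simpa using h2 e (Finset.mem_univ _)
  refine ⟨fun e κ => H e x₀ (x₀, κ), fun e x s κ => ?_, ?_⟩
  · split_ifs with h
    · subst h
      rw [← sub_eq_zero]
      refine vanish (fun κ e => H e x (x, κ) - H e x₀ (x₀, κ)) ?_ κ e
      simp only [star_sub, sub_mul, mul_sub, Finset.sum_sub_distrib, hH, and_self, if_true,
        sub_self]
    · exact vanish (fun κ e => H e x (s, κ)) ((hH x x s s).trans (by simp [h])) κ e
  · have h1 := hH x₀ x₀ x₀ x₀
    rw [Finset.sum_comm] at h1
    simp only [and_self, if_true, Complex.star_def, Complex.mul_conj'] at h1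
    exact_mod_cast h1

/-- The weight along `v` depends on `F` only through its Gram matrix on Bob's side, so vectors with
the same marginal there have the same weight. -/
lemma sum_norm_sum_sq {ι b : Type*} [Fintype ι] [Fintype b] (v : b → ℂ) (F : ι → b → ℂ) :
    ((∑ i, ‖∑ β, v β * F i β‖ ^ 2 : ℝ) : ℂ)
      = ∑ β, ∑ β', v β * star (v β') * ∑ i, F i β * star (F i β') := by
  calc ((∑ i, ‖∑ β, v β * F i β‖ ^ 2 : ℝ) : ℂ)
      = ∑ i, ∑ p : b × b, v p.1 * star (v p.2) * (F i p.1 * star (F i p.2)) := by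
        simp only [Complex.ofReal_sum, Complex.ofReal_pow, ← Complex.mul_conj', map_sum,
          Finset.sum_mul_sum, map_mul, Complex.star_def, Fintype.sum_prod_type]
        refine Finset.sum_congr rfl fun i _ => Finset.sum_congr rfl fun β _ =>
          Finset.sum_congr rfl fun β' _ => ?_
        ring
    _ = _ := by
        rw [Finset.sum_comm]
        simp only [Finset.mul_sum, Fintype.sum_prod_type]

theorem IsOneTimePad.le {a b : Type*} [Fintype a] [DecidableEq a] [Fintype b] [DecidableEq b]
    {d : ℕ} (hd : 1 ≤ d) {Ψ : EuclideanSpace ℂ (a × b)} (hΨ : ‖Ψ‖ = 1) (h : IsOneTimePad d Ψ)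
    (v : b → ℂ) : d * ∑ i, ‖(coeff Ψ *ᵥ v) i‖ ^ 2 ≤ ∑ j, ‖v j‖ ^ 2 := by
  obtain ⟨n, Φ, -, ⟨E, hE, hΦ⟩, ⟨σ, hσ⟩, k, M, hM, hM', hrec⟩ := h
  have : Nonempty (Fin d) := ⟨⟨0, hd⟩⟩
  obtain ⟨m, G, hG⟩ := hE.exists_code Ψ
  let ψ₀ : State d := ⟨_, isDensity_smul_vecMulVec (u := fun _ : Fin d => (1 : ℂ))
    (fun h => one_ne_zero (congrFun h ⟨0, hd⟩))⟩
  have htr : (marginalA Ψ).trace = 1 := by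
    rw [marginalA_eq, trace_mul_comm, trace_coeff, hΨ]
    simp
  have hσtr : σ.trace = 1 := by
    rw [← hσ ψ₀, hΦ, hE.trace_preserving, trace_kronecker, ψ₀.2.2, htr, one_mul]
  -- secrecy, extended to all operators
  have hsecL : ∀ Y : Matrix (Fin d) (Fin d) ℂ, E (Y ⊗ₖ marginalA Ψ) = Y.trace • σ := by
    intro Y
    let f : Matrix (Fin d) (Fin d) ℂ →ₗ[ℂ] Matrix (Fin n) (Fin n) ℂ :=
      E ∘ₗ (kroneckerBilinear (R := ℂ) (α := ℂ) (l := Fin d) (m := Fin d)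
        (n := a) (p := a)).flip (marginalA Ψ)
    let g : Matrix (Fin d) (Fin d) ℂ →ₗ[ℂ] Matrix (Fin n) (Fin n) ℂ :=
      (traceLinearMap (Fin d) ℂ ℂ).smulRight σ
    have : f = g := linearMap_ext_state fun ψ => by
      have h1 : E (ψ.1 ⊗ₖ marginalA Ψ) = σ := by rw [← hΦ, hσ]
      have h2 : g ψ.1 = σ := by simp [g, ψ.2.2]
      rw [h2]
      exact h1
    exact LinearMap.congr_fun this Y
  have hsec : ∀ x y α α', ∑ e, ∑ β, G e x (α, β) * star (G e y (α', β))
      = if x = y then σ α α' else 0 := by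
    intro x y α α'
    have h1 := congrFun (congrFun (hsecL (single x y 1)) α) α'
    rw [marginalA_eq_sum_dyadBlock] at h1
    have h2 : (single x y (1 : ℂ) ⊗ₖ ∑ β, dyadBlock Ψ β β)
        = ∑ β, single x y (1 : ℂ) ⊗ₖ dyadBlock Ψ β β :=
      map_sum (kroneckerBilinear (R := ℂ) (α := ℂ) (l := Fin d) (m := Fin d) (n := a) (p := a)
        (single x y 1)) _ _
    rw [h2, map_sum, Matrix.sum_apply] at h1
    rw [Finset.sum_comm]
    simp only [hG x y (α, _) (α', _)] at h1
    rw [h1]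
    by_cases hxy : x = y
    · simp [hxy]
    · simp [hxy, trace_single_eq_of_ne]
  -- recovery, extended to all operators
  have hrecL : ∀ Y : Matrix (Fin d) (Fin d) ℂ, ptraceRight (Mᴴ *
      (of fun p q : Fin n × b => E (Y ⊗ₖ dyadBlock Ψ p.2 q.2) p.1 q.1) * M) = Y := by
    intro Y
    let f : Matrix (Fin d) (Fin d) ℂ →ₗ[ℂ] Matrix (Fin d) (Fin d) ℂ :=
      { toFun := fun Y => ptraceRight (Mᴴ *
          (of fun p q : Fin n × b => E (Y ⊗ₖ dyadBlock Ψ p.2 q.2) p.1 q.1) * M)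
        map_add' := fun Y Z => by
          ext i j
          simp only [ptraceRight, add_kronecker, map_add, Matrix.add_apply, mul_apply, of_apply,
            mul_add, add_mul, Finset.sum_add_distrib]
        map_smul' := fun c Y => by
          ext i j
          simp only [ptraceRight, smul_kronecker, map_smul, Matrix.smul_apply, mul_apply, of_apply,
            smul_eq_mul, Finset.mul_sum, Finset.sum_mul, RingHom.id_apply]
          refine Finset.sum_congr rfl fun _ _ => Finset.sum_congr rfl fun _ _ =>
            Finset.sum_congr rfl fun _ _ => ?_
          ring }
    have : f = LinearMap.id := linearMap_ext_state fun ψ => by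
      have h1 := hrec ψ
      have h2 : onFirst (Φ ψ) (dyad Ψ)
          = of fun p q : Fin n × b => E (ψ.1 ⊗ₖ dyadBlock Ψ p.2 q.2) p.1 q.1 := by
        ext p q
        exact congrFun (congrFun (hΦ ψ (dyadBlock Ψ p.2 q.2)) p.1) q.1
      rw [h2] at h1
      exact h1
    exact LinearMap.congr_fun this Y
  let H : Fin m → Fin d → Fin d × Fin k → ℂ := fun e x => Mᴴ *ᵥ G e x
  have hH : ∀ x y s t, ∑ κ, ∑ e, H e x (s, κ) * star (H e y (t, κ))
      = if x = s ∧ y = t then 1 else 0 := by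
    intro x y s t
    have h1 := congrFun (congrFun (hrecL (single x y 1)) s) t
    have h2 : (of fun p q : Fin n × b => E (single x y 1 ⊗ₖ dyadBlock Ψ p.2 q.2) p.1 q.1)
        = ∑ e, vecMulVec (G e x) (star (G e y)) := by
      ext p q
      simp [hG, Matrix.sum_apply, vecMulVec_apply]
    have h3 : Mᴴ * (∑ e, vecMulVec (G e x) (star (G e y))) * M
        = ∑ e, vecMulVec (H e x) (star (H e y)) := by
      simp only [Matrix.mul_sum, Matrix.sum_mul, mul_vecMulVec, vecMulVec_mul, H, star_mulVec,
        conjTranspose_conjTranspose]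
    rw [h2, h3] at h1
    simp only [ptraceRight, Matrix.sum_apply, vecMulVec_apply, Pi.star_apply, single_apply] at h1
    exact h1
  obtain ⟨g, hg, hg1⟩ := exists_common_vector H hH
  have hGg : ∀ e x p, G e x p = ∑ κ, M p (x, κ) * g e κ := by
    intro e x p
    have h1 : G e x = M *ᵥ H e x := by simp [H, mulVec_mulVec, hM']
    rw [h1]
    simp [mulVec, dotProduct, Fintype.sum_prod_type, hg]
  have hbound := sum_component_le M hM' g hg1 σ hσtr G hGg hsec v
  -- the marginal of the second party is not changed by the encoding
  have hB : ∀ x β β', ∑ e, ∑ α, G e x (α, β) * star (G e x (α, β'))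
      = ∑ i, Ψ (i, β) * star (Ψ (i, β')) := by
    intro x β β'
    have h1 := hE.trace_preserving (single x x 1 ⊗ₖ dyadBlock Ψ β β')
    rw [trace_kronecker, trace_single_eq_same, one_mul, trace] at h1
    simp only [diag_apply, hG x x (_, β) (_, β')] at h1
    rw [Finset.sum_comm, h1]
    rfl
  have hx : ∀ x, ∑ e, ∑ α, ‖∑ β, v β * G e x (α, β)‖ ^ 2 = ∑ i, ‖(coeff Ψ *ᵥ v) i‖ ^ 2 := by
    intro x
    have h1 := sum_norm_sum_sq v (fun (q : Fin m × Fin n) β => G q.1 x (q.2, β))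
    have h2 := sum_norm_sum_sq v (fun (i : a) (β : b) => Ψ (i, β))
    simp only [Fintype.sum_prod_type, hB] at h1
    rw [← h2] at h1
    have h3 : ∀ i, (coeff Ψ *ᵥ v) i = ∑ β, v β * Ψ (i, β) := fun i => by
      simp [mulVec, dotProduct, mul_comm]
    simp only [h3]
    exact_mod_cast h1
  simpa [hx] using hbound

end Necessity

/-! ### Channels from Kraus operators and ancillas. -/

section Channels

/-- The completely positive map with Kraus operators `K`. -/
def krausMap {ι m n : Type*} [Fintype ι] [Fintype m] (K : ι → Matrix n m ℂ) :
    Matrix m m ℂ →ₗ[ℂ] Matrix n n ℂ where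
  toFun X := ∑ e, K e * X * (K e)ᴴ
  map_add' X Y := by simp only [Matrix.mul_add, Matrix.add_mul, Finset.sum_add_distrib]
  map_smul' c X := by
    simp only [Matrix.mul_smul, Matrix.smul_mul, Finset.smul_sum, RingHom.id_apply]

lemma krausMap_apply {ι m n : Type*} [Fintype ι] [Fintype m] (K : ι → Matrix n m ℂ)
    (X : Matrix m m ℂ) : krausMap K X = ∑ e, K e * X * (K e)ᴴ := rfl

lemma onFirst_krausMap {ι m n r : Type*} [Fintype ι] [Fintype m] [Fintype r] [DecidableEq r]
    (K : ι → Matrix n m ℂ) (X : Matrix (m × r) (m × r) ℂ) :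
    onFirst (krausMap K) X
      = ∑ e, (K e ⊗ₖ (1 : Matrix r r ℂ)) * X * (K e ⊗ₖ (1 : Matrix r r ℂ))ᴴ := by
  ext ⟨c, s⟩ ⟨c', s'⟩
  change (∑ e, K e * (of fun i j => X (i, s) (j, s')) * (K e)ᴴ) c c' = _
  simp [Matrix.sum_apply, mul_apply, Fintype.sum_prod_type, one_apply,
    apply_ite (starRingEnd ℂ)]

lemma isChannel_krausMap {ι m n : Type*} [Fintype ι] [Fintype m] [Fintype n] [DecidableEq m]
    {K : ι → Matrix n m ℂ} (hK : ∑ e, (K e)ᴴ * K e = 1) : IsChannel (krausMap K) where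
  completely_positive k X hX := by
    rw [onFirst_krausMap]
    exact posSemidef_sum _ fun e _ => hX.mul_mul_conjTranspose_same _
  trace_preserving X := by
    have h1 : ∀ e, (K e * X * (K e)ᴴ).trace = ((K e)ᴴ * K e * X).trace := fun e => by
      rw [trace_mul_comm, Matrix.mul_assoc]
    rw [krausMap_apply, trace_sum]
    simp only [h1]
    rw [← trace_sum, ← Matrix.sum_mul, hK, Matrix.one_mul]

/-- The channel that adjoins an ancilla in the state `ψ` and then applies `E`. -/
def adjoinState {s a n : Type*} (E : Matrix (s × a) (s × a) ℂ →ₗ[ℂ] Matrix n n ℂ)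
    (ψ : Matrix s s ℂ) : Matrix a a ℂ →ₗ[ℂ] Matrix n n ℂ :=
  E ∘ₗ kroneckerBilinear (R := ℂ) ψ

lemma adjoinState_apply {s a n : Type*} (E : Matrix (s × a) (s × a) ℂ →ₗ[ℂ] Matrix n n ℂ)
    (ψ : Matrix s s ℂ) (X : Matrix a a ℂ) : adjoinState E ψ X = E (ψ ⊗ₖ X) := rfl

lemma IsChannel.adjoinState {s a n : Type*} [Fintype s] [Fintype a] [Fintype n]
    {E : Matrix (s × a) (s × a) ℂ →ₗ[ℂ] Matrix n n ℂ} (hE : IsChannel E) {ψ : Matrix s s ℂ}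
    (hψ : IsDensity ψ) : IsChannel (adjoinState E ψ) where
  completely_positive k X hX := by
    have h1 := hE.completely_positive k _
      ((hψ.1.kronecker hX).submatrix (Equiv.prodAssoc s a (Fin k)))
    exact h1
  trace_preserving X := by
    rw [adjoinState_apply, hE.trace_preserving, trace_kronecker, hψ.2, one_mul]

lemma onFirst_adjoinState {s a b n : Type*} (E : Matrix (s × a) (s × a) ℂ →ₗ[ℂ] Matrix n n ℂ)
    (ψ : Matrix s s ℂ) (Ψ : EuclideanSpace ℂ (a × b)) :
    onFirst (adjoinState E ψ) (dyad Ψ)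
      = of fun p q => E (ψ ⊗ₖ dyadBlock Ψ p.2 q.2) p.1 q.1 := rfl

end Channels

/-! ### Measure-and-prepare channels. -/

section Measurement

/-- The matrix that prepares the register state `c` with the outcome vector `f c`, or the state
`c₀` for the outcomes outside of the range of the projection `1 ⊗ P`. -/
def measureKraus {d a n : Type*} [DecidableEq d] [DecidableEq a] [DecidableEq n]
    (f : n → d × a → ℂ) (P : Matrix a a ℂ) (c₀ : n) : n ⊕ (d × a) → Matrix n (d × a) ℂ
  | Sum.inl c => vecMulVec (Pi.single c 1) (star (f c))
  | Sum.inr q => vecMulVec (Pi.single c₀ 1) (((1 : Matrix d d ℂ) ⊗ₖ (1 - P)) q)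

variable {d a b n : Type*} [Fintype d] [Fintype a] [Fintype n]
  [DecidableEq d] [DecidableEq a] [DecidableEq n]

lemma sum_measureKraus {f : n → d × a → ℂ} {P : Matrix a a ℂ} (c₀ : n) (hP : Pᴴ = P)
    (hP2 : P * P = P) (hf : ∑ c, vecMulVec (f c) (star (f c)) = (1 : Matrix d d ℂ) ⊗ₖ P) :
    ∑ e, (measureKraus f P c₀ e)ᴴ * measureKraus f P c₀ e = 1 := by
  have h0 : ∀ (c : n) (u : d × a → ℂ), (vecMulVec (Pi.single c 1 : n → ℂ) u)ᴴ *
      vecMulVec (Pi.single c 1 : n → ℂ) u = vecMulVec (star u) u := by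
    intro c u
    ext i j
    simp [mul_apply, vecMulVec_apply, Pi.single_apply]
  have h1 : ∑ q : d × a, vecMulVec (star (((1 : Matrix d d ℂ) ⊗ₖ (1 - P)) q))
      (((1 : Matrix d d ℂ) ⊗ₖ (1 - P)) q) = (1 : Matrix d d ℂ) ⊗ₖ (1 - P) := by
    have h2 : ((1 : Matrix d d ℂ) ⊗ₖ (1 - P))ᴴ * ((1 : Matrix d d ℂ) ⊗ₖ (1 - P))
        = (1 : Matrix d d ℂ) ⊗ₖ (1 - P) := by
      rw [conjTranspose_kronecker, ← mul_kronecker_mul, conjTranspose_one, Matrix.one_mul,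
        conjTranspose_sub, conjTranspose_one, hP, Matrix.sub_mul, Matrix.mul_sub, Matrix.mul_sub,
        hP2]
      simp
    conv_rhs => rw [← h2]
    ext i j
    simp only [Matrix.sum_apply, vecMulVec_apply, mul_apply, conjTranspose_apply, Pi.star_apply]
  rw [Fintype.sum_sum_type]
  simp only [measureKraus, h0, star_star, hf, h1]
  rw [← kronecker_add, add_sub_cancel, one_kronecker_one]

/-- The extra outcomes never occur, because `1 - P` annihilates Alice's side of `Ψ`. What remains is
a classical register `c` with Bob's conditional vectors beside it. -/
lemma krausMap_measureKraus_apply {f : n → d × a → ℂ} {P : Matrix a a ℂ} (c₀ : n)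
    {Ψ : EuclideanSpace ℂ (a × b)} (hPΨ : P * coeff Ψ = coeff Ψ)
    {t : n → ℂ} {w : n → d → b → ℂ}
    (hw : ∀ c s β, ∑ i, star (f c (s, i)) * Ψ (i, β) = t c * w c s β)
    (Y : Matrix d d ℂ) (β β' : b) (c c' : n) :
    krausMap (measureKraus f P c₀) (Y ⊗ₖ dyadBlock Ψ β β') c c'
      = if c = c' then t c * star (t c) * ∑ s, ∑ s', Y s s' * (w c s β * star (w c s' β'))
        else 0 := by
  have h0 : ∀ q, measureKraus f P c₀ (Sum.inr q) * (Y ⊗ₖ dyadBlock Ψ β β') = 0 := by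
    intro q
    have h1 : (1 - P) * dyadBlock Ψ β β' = 0 := by
      have h2 : dyadBlock Ψ β β' = vecMulVec (fun i => Ψ (i, β)) (star fun i => Ψ (i, β')) := rfl
      have h3 : P *ᵥ (fun i => Ψ (i, β)) = fun i => Ψ (i, β) :=
        funext fun i => congrFun (congrFun hPΨ i) β
      rw [h2, mul_vecMulVec, sub_mulVec, h3, one_mulVec, sub_self]
      ext
      simp [vecMulVec_apply]
    have h3 : ((1 : Matrix d d ℂ) ⊗ₖ (1 - P)) q ᵥ* (Y ⊗ₖ dyadBlock Ψ β β') = 0 := by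
      have h4 : ((1 : Matrix d d ℂ) ⊗ₖ (1 - P)) * (Y ⊗ₖ dyadBlock Ψ β β') = 0 := by
        rw [← mul_kronecker_mul, h1, kronecker_zero]
      exact congrFun h4 q
    rw [measureKraus, vecMulVec_mul, h3]
    ext
    simp [vecMulVec_apply]
  have h1 : ∀ e, (measureKraus f P c₀ (Sum.inl e) * (Y ⊗ₖ dyadBlock Ψ β β') *
      (measureKraus f P c₀ (Sum.inl e))ᴴ) c c' = if c = e ∧ c' = e then
        ∑ s, ∑ s', Y s s' * ((t e * w e s β) * star (t e * w e s' β')) else 0 := by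
    intro e
    rw [measureKraus, vecMulVec_mul, conjTranspose_vecMulVec, star_star, vecMulVec_mul_vecMulVec,
      vecMulVec_apply, Pi.smul_apply]
    have h5 : star (f e) ᵥ* (Y ⊗ₖ dyadBlock Ψ β β') ⬝ᵥ f e
        = ∑ s, ∑ s', Y s s' * ((t e * w e s β) * star (t e * w e s' β')) := by
      simp only [← hw, star_sum, Finset.sum_mul_sum]
      simp only [dotProduct, vecMul, Fintype.sum_prod_type, kroneckerMap_apply, dyadBlock, dyad,
        Finset.sum_mul, Finset.mul_sum, Pi.star_apply, star_mul', star_star]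
      symm
      rw [Finset.sum_comm]
      refine Finset.sum_congr rfl fun s' _ => ?_
      symm
      rw [Finset.sum_comm]
      refine Finset.sum_congr rfl fun s _ => ?_
      rw [Finset.sum_comm]
      refine Finset.sum_congr rfl fun i _ => Finset.sum_congr rfl fun j _ => ?_
      ring
    rw [h5]
    by_cases h6 : c = e <;> by_cases h7 : c' = e <;> simp [h6, h7]
  rw [krausMap_apply, Fintype.sum_sum_type]
  simp only [h0, Matrix.zero_mul, Finset.sum_const_zero, add_zero, Matrix.sum_apply, h1]
  by_cases hc : c = c'
  · subst hc
    simp only [and_self, Finset.sum_ite_eq, Finset.mem_univ, if_true, Finset.mul_sum, star_mul']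
    refine Finset.sum_congr rfl fun s _ => Finset.sum_congr rfl fun s' _ => ?_
    ring
  · rw [if_neg hc]
    refine Finset.sum_eq_zero fun e _ => if_neg ?_
    rintro ⟨rfl, rfl⟩
    exact hc rfl

end Measurement

/-! ### From a measurement to a one-time pad. -/

section Protocol

lemma ptraceRight_kronecker {m n : Type*} [Fintype n] (X : Matrix m m ℂ) (Y : Matrix n n ℂ) :
    ptraceRight (X ⊗ₖ Y) = Y.trace • X := by
  ext i j
  simp [ptraceRight, trace, ← Finset.mul_sum, mul_comm]

/-- Orthonormal vectors controlled by a classical register, as the columns of a unitary. -/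
lemma exists_unitary_extension {b : Type*} [Fintype b] [DecidableEq b] {d n k : ℕ}
    (hcard : n * Fintype.card b = d * k) (ι : Fin n ↪ Fin k) (w : Fin n → Fin d → b → ℂ)
    (hw : ∀ c s s', ∑ β, star (w c s β) * w c s' β = if s = s' then 1 else 0) :
    ∃ M : Matrix (Fin n × b) (Fin d × Fin k) ℂ, Mᴴ * M = 1 ∧ M * Mᴴ = 1 ∧
      ∀ p s c, M p (s, ι c) = if p.1 = c then w c s p.2 else 0 := by
  let v : Fin d × Fin k → EuclideanSpace ℂ (Fin n × b) := fun q =>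
    WithLp.toLp 2 fun p => if ι p.1 = q.2 then w p.1 q.1 p.2 else 0
  have hv : Orthonormal ℂ (({q | q.2 ∈ Set.range ι} : Set (Fin d × Fin k)).domRestrict v) := by
    rw [orthonormal_iff_ite]
    rintro ⟨⟨s, κ⟩, ⟨c, hκ⟩⟩ ⟨⟨s', κ'⟩, ⟨c', hκ'⟩⟩
    obtain rfl : ι c = κ := hκ
    obtain rfl : ι c' = κ' := hκ'
    have h1 : inner ℂ (v (s, ι c)) (v (s', ι c'))
        = if c = c' then ∑ β, star (w c s β) * w c s' β else 0 := by
      rw [PiLp.inner_apply, Fintype.sum_prod_type]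
      by_cases hc : c = c'
      · subst hc
        rw [Finset.sum_eq_single c]
        · simp [v, mul_comm]
        · intro x _ hx
          simp [v, hx]
        · simp
      · rw [if_neg hc]
        refine Finset.sum_eq_zero fun x _ => Finset.sum_eq_zero fun β _ => ?_
        by_cases hx : x = c
        · subst hx
          simp [v, hc]
        · simp [v, hx]
    rw [hw] at h1
    refine h1.trans ?_
    by_cases hc : c = c' <;> by_cases hs : s = s' <;> simp [hc, hs, Subtype.ext_iff]
  obtain ⟨B, hB⟩ := hv.exists_orthonormalBasis_extension_of_card_eq (by simp [hcard])
  let M : Matrix (Fin n × b) (Fin d × Fin k) ℂ := of fun p q => B q p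
  have hM : Mᴴ * M = 1 := by
    ext q q'
    have h1 := orthonormal_iff_ite.1 B.orthonormal q q'
    rw [PiLp.inner_apply] at h1
    rw [one_apply, ← h1]
    simp [mul_apply, M, mul_comm]
  refine ⟨M, hM, ?_, fun p s c => ?_⟩
  · refine (mul_eq_one_comm_of_equiv (Fintype.equivOfCardEq ?_)).1 hM
    simp [hcard]
  · have h1 := hB (s, ι c) ⟨c, rfl⟩
    change B (s, ι c) p = _
    rw [h1]
    by_cases hp : p.1 = c
    · simp [v, hp]
    · simp [v, hp]

/-- A measurement of `S` and `A` whose outcomes reveal nothing and leave Bob with an isometric image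
of the input gives a one-time pad. -/
lemma isOneTimePad_of_measurement {a b : Type*} [Fintype a] [DecidableEq a] [Fintype b]
    [DecidableEq b] {d n k : ℕ} (Ψ : EuclideanSpace ℂ (a × b))
    (hcard : n * Fintype.card b = d * k) (ι : Fin n ↪ Fin k)
    {f : Fin n → Fin d × a → ℂ} {P : Matrix a a ℂ} (hP : Pᴴ = P) (hP2 : P * P = P)
    (hf : ∑ c, vecMulVec (f c) (star (f c)) = (1 : Matrix (Fin d) (Fin d) ℂ) ⊗ₖ P)
    (hPΨ : P * coeff Ψ = coeff Ψ) {t : Fin n → ℂ} {w : Fin n → Fin d → b → ℂ}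
    (ht : ∑ c, t c * star (t c) = 1)
    (hw : ∀ c s s', ∑ β, star (w c s β) * w c s' β = if s = s' then 1 else 0)
    (hfw : ∀ c s β, ∑ i, star (f c (s, i)) * Ψ (i, β) = t c * w c s β) :
    IsOneTimePad d Ψ := by
  have hn : Nonempty (Fin n) := by
    by_contra h
    rw [not_nonempty_iff] at h
    simp at ht
  obtain ⟨c₀⟩ := hn
  obtain ⟨M, hM, hM', hMw⟩ := exists_unitary_extension hcard ι w hw
  set E := krausMap (measureKraus f P c₀) with hE
  have hEchan : IsChannel E := isChannel_krausMap (sum_measureKraus c₀ hP hP2 hf)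
  have hEapply := krausMap_measureKraus_apply (P := P) c₀ hPΨ hfw
  refine ⟨n, fun ψ => adjoinState E ψ.1, fun ψ => hEchan.adjoinState ψ.2,
    ⟨E, hEchan, fun _ _ => rfl⟩, ⟨diagonal fun c => t c * star (t c), fun ψ => ?_⟩,
    k, M, hM, hM', fun ψ => ?_⟩
  · have h1 : adjoinState E ψ.1 (marginalA Ψ) = ∑ β, E (ψ.1 ⊗ₖ dyadBlock Ψ β β) := by
      rw [marginalA_eq_sum_dyadBlock, map_sum]
      rfl
    rw [h1]
    ext c c'
    simp only [Matrix.sum_apply, hE, hEapply, diagonal_apply]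
    split_ifs with hc
    · have h2 : ∑ β, ∑ s, ∑ s', ψ.1 s s' * (w c s β * star (w c s' β)) = 1 := by
        rw [Finset.sum_comm, ← ψ.2.2, trace]
        refine Finset.sum_congr rfl fun s _ => ?_
        rw [Finset.sum_comm]
        have h3 : ∀ s', ∑ β, w c s β * star (w c s' β) = if s' = s then 1 else 0 := fun s' => by
          rw [← hw]
          exact Finset.sum_congr rfl fun β _ => mul_comm _ _
        simp only [← Finset.mul_sum, h3]
        simp
      rw [← Finset.mul_sum, h2, mul_one]
    · simp
  -- The joint output is `V (ψ ⊗ D) Vᴴ`, and `M` extends the isometry `V` along the embedding `J` of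
  -- registers. Undoing `M` therefore leaves `ψ` in tensor product with a fixed state.
  · let V : Matrix (Fin n × b) (Fin d × Fin n) ℂ :=
      of fun p q => if p.1 = q.2 then w q.2 q.1 p.2 else 0
    let D : Matrix (Fin n) (Fin n) ℂ := diagonal fun c => t c * star (t c)
    let J : Matrix (Fin k) (Fin n) ℂ := of fun κ c => if κ = ι c then 1 else 0
    have hMJ : M * ((1 : Matrix (Fin d) (Fin d) ℂ) ⊗ₖ J) = V := by
      ext p ⟨s, c⟩
      simp [mul_apply, Fintype.sum_prod_type, one_apply, J, V, hMw]
    have hMV : Mᴴ * V = (1 : Matrix (Fin d) (Fin d) ℂ) ⊗ₖ J := by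
      rw [← hMJ, ← Matrix.mul_assoc, hM, Matrix.one_mul]
    have hVM : Vᴴ * M = (1 : Matrix (Fin d) (Fin d) ℂ) ⊗ₖ Jᴴ := by
      have := congrArg conjTranspose hMV
      simpa [conjTranspose_kronecker] using this
    have hout : onFirst (adjoinState E ψ.1) (dyad Ψ) = V * (ψ.1 ⊗ₖ D) * Vᴴ := by
      rw [onFirst_adjoinState]
      ext ⟨c, β⟩ ⟨c', β'⟩
      simp only [of_apply, hE, hEapply]
      simp only [mul_apply, Fintype.sum_prod_type, V, D, of_apply, conjTranspose_apply,
        kroneckerMap_apply, diagonal_apply, mul_ite, mul_zero, ite_mul, zero_mul,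
        Finset.sum_ite_eq, Finset.sum_ite_eq', Finset.mem_univ, if_true, apply_ite star, star_zero]
      split_ifs with hc
      · subst hc
        simp only [Finset.mul_sum, Finset.sum_mul]
        rw [Finset.sum_comm]
        refine Finset.sum_congr rfl fun s _ => Finset.sum_congr rfl fun s' _ => ?_
        ring
      · simp
    have hJ : Jᴴ * J = 1 := by
      ext c c'
      simp [mul_apply, J, one_apply, apply_ite (starRingEnd ℂ), ι.injective.eq_iff, eq_comm]
    have h1 : Mᴴ * (V * (ψ.1 ⊗ₖ D) * Vᴴ) * M = ψ.1 ⊗ₖ (J * D * Jᴴ) := by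
      calc Mᴴ * (V * (ψ.1 ⊗ₖ D) * Vᴴ) * M = (Mᴴ * V) * (ψ.1 ⊗ₖ D) * (Vᴴ * M) := by
            simp only [Matrix.mul_assoc]
        _ = _ := by
            rw [hMV, hVM, ← mul_kronecker_mul, ← mul_kronecker_mul, Matrix.one_mul, Matrix.mul_one]
    rw [hout, h1, ptraceRight_kronecker, trace_mul_comm, ← Matrix.mul_assoc, hJ, Matrix.one_mul,
      trace_diagonal, ht, one_smul]

/-- The hypotheses of `isOneTimePad_of_measurement` do not depend on the labels of the outcomes. -/
lemma isOneTimePad_of_measurement' {C a b : Type*} [Fintype C] [Fintype a] [DecidableEq a]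
    [Fintype b] [DecidableEq b] {d : ℕ} (Ψ : EuclideanSpace ℂ (a × b))
    (hd : d ∣ Fintype.card C) (hdb : d ≤ Fintype.card b)
    {f : C → Fin d × a → ℂ} {P : Matrix a a ℂ} (hP : Pᴴ = P) (hP2 : P * P = P)
    (hf : ∑ c, vecMulVec (f c) (star (f c)) = (1 : Matrix (Fin d) (Fin d) ℂ) ⊗ₖ P)
    (hPΨ : P * coeff Ψ = coeff Ψ) {t : C → ℂ} {w : C → Fin d → b → ℂ}
    (ht : ∑ c, t c * star (t c) = 1)
    (hw : ∀ c s s', ∑ β, star (w c s β) * w c s' β = if s = s' then 1 else 0)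
    (hfw : ∀ c s β, ∑ i, star (f c (s, i)) * Ψ (i, β) = t c * w c s β) :
    IsOneTimePad d Ψ := by
  obtain ⟨l, hl⟩ := hd
  let e := (Fintype.equivFin C).symm
  -- The choice `k = l * card b` equates the dimensions of `A' ⊗ B` and `S ⊗ E`; `d ≤ card b` then
  -- makes room in `E` for the whole register.
  have hle : Fintype.card C ≤ l * Fintype.card b := by
    rw [hl, mul_comm]
    exact Nat.mul_le_mul_left l hdb
  refine isOneTimePad_of_measurement (n := Fintype.card C) (k := l * Fintype.card b) Ψ
    (by rw [hl, mul_assoc]) (Fin.castLEEmb hle) (f := f ∘ e) hP hP2 ?_ hPΨ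
    (t := t ∘ e) (w := w ∘ e) ?_ (fun c => hw (e c)) (fun c => hfw (e c))
  · rw [← hf]
    exact e.sum_comp fun c => vecMulVec (f c) (star (f c))
  · rw [← ht]
    exact e.sum_comp fun c => t c * star (t c)

end Protocol

/-! ### Orthogonal phases and Birkhoff's theorem. -/

section Combinatorics

/-- These are the additive characters of `ZMod d`. Any bijection with `Fin d` will do, since only
orthogonality and modulus one are needed. -/
lemma exists_orthogonal_phases (d : ℕ) [NeZero d] : ∃ χ : Fin d → Fin d → ℂ,
    (∀ z s, χ z s * star (χ z s) = 1) ∧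
      ∀ s s', ∑ z, χ z s * star (χ z s') = if s = s' then (d : ℂ) else 0 := by
  let e : Fin d ≃ ZMod d := Fintype.equivOfCardEq (by rw [ZMod.card, Fintype.card_fin])
  have h : ∀ z s s' : ZMod d, ZMod.stdAddChar (z * s) * star (ZMod.stdAddChar (z * s'))
      = ZMod.stdAddChar (z * (s - s')) := by
    intro z s s'
    rw [mul_sub, sub_eq_add_neg, AddChar.map_add_eq_mul, AddChar.map_neg_eq_conj]
    rfl
  refine ⟨fun z s => ZMod.stdAddChar (e z * e s), fun z s => ?_, fun s s' => ?_⟩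
  · rw [h, sub_self, mul_zero, AddChar.map_zero_eq_one]
  · simp only [h]
    rw [e.sum_comp fun z => ZMod.stdAddChar (z * (e s - e s')),
      AddChar.sum_mulShift _ (ZMod.isPrimitive_stdAddChar _), ZMod.card]
    simp [sub_eq_zero]

/-- A distribution with probabilities at most `1 / d` is a mixture of uniform distributions on `d`
points. -/
lemma exists_perm_mixture {b : Type*} [Fintype b] [DecidableEq b] {d : ℕ} {p : b → ℝ}
    (hp : ∀ i, 0 ≤ p i) (hp1 : ∑ i, p i = 1) (hpd : ∀ i, d * p i ≤ 1) :
    ∃ (ι : Fin d ↪ b) (q : Equiv.Perm b → ℝ), (∀ π, 0 ≤ q π) ∧ ∑ π, q π = 1 ∧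
      ∀ s i, ∑ π, (if π (ι s) = i then q π else 0) = p i := by
  have hcard : d ≤ Fintype.card b := by
    have h1 : ∑ i : b, d * p i ≤ ∑ _i : b, 1 := Finset.sum_le_sum fun i _ => hpd i
    rw [← Finset.mul_sum, hp1] at h1
    simp only [mul_one, Finset.sum_const, Finset.card_univ, nsmul_eq_mul] at h1
    exact_mod_cast h1
  obtain ⟨ι⟩ : Nonempty (Fin d ↪ b) := Function.Embedding.nonempty_of_card_le (by simpa)
  let R : Finset b := Finset.univ.map ι
  have hR : R.card = d := by simp [R]
  have hRc : (Rᶜ).card = Fintype.card b - d := by rw [Finset.card_compl, hR]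
  have hRc' : ((Rᶜ).card : ℝ) = Fintype.card b - d := by rw [hRc, Nat.cast_sub hcard]
  -- Repeat `p` in `d` rows and share the rest of each column equally among the other rows; `d * p i
  -- ≤ 1` keeps those entries nonnegative. Birkhoff's theorem then supplies the permutations.
  let N : Matrix b b ℝ := of fun r i => if r ∈ R then p i else (1 - d * p i) / (Rᶜ).card
  have hsum : ∑ i, (1 - d * p i) = (Rᶜ).card := by
    rw [Finset.sum_sub_distrib, ← Finset.mul_sum, hp1, hRc']
    simp
  have hN : N ∈ doublyStochastic ℝ b := by
    rw [mem_doublyStochastic_iff_sum]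
    refine ⟨fun r i => ?_, fun r => ?_, fun i => ?_⟩
    · simp only [N, of_apply]
      split_ifs
      · exact hp i
      · exact div_nonneg (sub_nonneg.2 (hpd i)) (Nat.cast_nonneg _)
    · simp only [N, of_apply]
      split_ifs with hr
      · exact hp1
      · rw [← Finset.sum_div, hsum, div_self]
        exact_mod_cast (Finset.card_pos.2 ⟨r, Finset.mem_compl.2 hr⟩).ne'
    · have h1 : ∑ r ∈ R, N r i = d * p i := by
        rw [Finset.sum_congr rfl fun r hr => show N r i = p i from if_pos hr]
        simp [hR]
      have h2 : ∑ r ∈ Rᶜ, N r i = (Rᶜ).card * ((1 - d * p i) / (Rᶜ).card) := by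
        rw [Finset.sum_congr rfl fun r hr => show N r i = (1 - d * p i) / (Rᶜ).card from
          if_neg (Finset.mem_compl.1 hr)]
        simp
      rw [← Finset.sum_add_sum_compl R, h1, h2]
      -- With no rows left over, the quotient is a division by zero; the numerators then sum to
      -- zero, so each vanishes and `d * p i = 1`.
      by_cases h0 : ((Rᶜ).card : ℝ) = 0
      · have h3 := (Finset.sum_eq_zero_iff_of_nonneg fun i _ => sub_nonneg.2 (hpd i)).1
          (hsum.trans h0) i (Finset.mem_univ i)
        rw [h0]
        linarith
      · field_simp
        ring
  obtain ⟨q, hq, hq1, hqN⟩ := exists_eq_sum_perm_of_mem_doublyStochastic hN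
  refine ⟨ι, q, hq, hq1, fun s i => ?_⟩
  have h1 := congrFun (congrFun hqN (ι s)) i
  have h2 : N (ι s) i = p i := if_pos (by simp [R])
  rw [h2, Matrix.sum_apply] at h1
  rw [← h1]
  refine Finset.sum_congr rfl fun π _ => ?_
  simp [PEquiv.toMatrix_apply, Equiv.toPEquiv_apply, eq_comm]

end Combinatorics

/-! ### Teleportation through random maximally entangled blocks. -/

section Sufficiency

/-- Diagonalization of `Cᴴ * C`, where `C` has operator norm at most `1 / √d`. -/
lemma exists_diagonalization {a b : Type*} [Fintype a] [Fintype b] [DecidableEq b] {d : ℕ}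
    {C : Matrix a b ℂ} (hC1 : (Cᴴ * C).trace = 1)
    (hC : ∀ v : b → ℂ, d * ∑ i, ‖(C *ᵥ v) i‖ ^ 2 ≤ ∑ j, ‖v j‖ ^ 2) :
    ∃ (U : Matrix b b ℂ) (p : b → ℝ), Uᴴ * U = 1 ∧ U * Uᴴ = 1 ∧
      (C * U)ᴴ * (C * U) = diagonal (fun i => (p i : ℂ)) ∧
      (∀ i, 0 ≤ p i) ∧ ∑ i, p i = 1 ∧ ∀ i, d * p i ≤ 1 := by
  have hA := isHermitian_conjTranspose_mul_self C
  let U : Matrix b b ℂ := hA.eigenvectorUnitary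
  have hU : Uᴴ * U = 1 := Unitary.coe_star_mul_self hA.eigenvectorUnitary
  have hU' : U * Uᴴ = 1 := Unitary.coe_mul_star_self hA.eigenvectorUnitary
  have hdiag : (C * U)ᴴ * (C * U) = diagonal (fun i => (hA.eigenvalues i : ℂ)) := by
    have h1 := hA.conjStarAlgAut_star_eigenvectorUnitary
    rw [Unitary.conjStarAlgAut_star_apply] at h1
    rw [conjTranspose_mul, ← Matrix.mul_assoc, Matrix.mul_assoc Uᴴ]
    exact h1
  have hp : ∀ i, hA.eigenvalues i = ∑ α, ‖(C *ᵥ fun β => U β i) α‖ ^ 2 := by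
    intro i
    have h1 := congrFun (congrFun hdiag i) i
    rw [diagonal_apply_eq, mul_apply] at h1
    have h2 : ∑ α, (C * U)ᴴ i α * (C * U) α i
        = ((∑ α, ‖(C *ᵥ fun β => U β i) α‖ ^ 2 : ℝ) : ℂ) := by
      push_cast
      refine Finset.sum_congr rfl fun α _ => ?_
      rw [← Complex.conj_mul']
      rfl
    exact_mod_cast (h2.symm.trans h1).symm
  have hcol : ∀ i, ∑ β, ‖U β i‖ ^ 2 = 1 := by
    intro i
    have h1 := congrFun (congrFun hU i) i
    rw [one_apply_eq, mul_apply] at h1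
    simp only [conjTranspose_apply, Complex.star_def, Complex.conj_mul'] at h1
    exact_mod_cast h1
  refine ⟨U, hA.eigenvalues, hU, hU', hdiag, fun i => ?_, ?_, fun i => ?_⟩
  · rw [hp]
    positivity
  · have h1 := congrArg trace hdiag
    rw [trace_diagonal, conjTranspose_mul, trace_mul_comm, Matrix.mul_assoc, ← Matrix.mul_assoc U,
      hU', Matrix.one_mul, trace_mul_comm, hC1] at h1
    exact_mod_cast h1.symm
  · rw [hp, ← hcol i]
    exact hC fun β => U β i

theorem isOneTimePad_of_le {a b : Type*} [Fintype a] [DecidableEq a] [Fintype b] [DecidableEq b]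
    {d : ℕ} (hd : 1 ≤ d) {Ψ : EuclideanSpace ℂ (a × b)} (hΨ : ‖Ψ‖ = 1)
    (h : ∀ v : b → ℂ, d * ∑ i, ‖(coeff Ψ *ᵥ v) i‖ ^ 2 ≤ ∑ j, ‖v j‖ ^ 2) :
    IsOneTimePad d Ψ := by
  have : NeZero d := ⟨by omega⟩
  have hd0 : (d : ℂ) ≠ 0 := NeZero.ne _
  obtain ⟨U, p, hU, hU', hdiag, hp, hp1, hpd⟩ :=
    exists_diagonalization (by rw [trace_coeff, hΨ]; simp) h
  obtain ⟨ι, q, hq, hq1, hqp⟩ := exists_perm_mixture hp hp1 hpd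
  obtain ⟨χ, hχ, hχ'⟩ := exists_orthogonal_phases d
  set A := coeff Ψ * U with hA
  have hAU : A * Uᴴ = coeff Ψ := by rw [hA, Matrix.mul_assoc, hU', Matrix.mul_one]
  -- Here `0⁻¹ = 0` makes `D` a pseudo-inverse, so `A * D * Aᴴ` is the support projection of Alice's
  -- marginal.
  let D : Matrix b b ℂ := diagonal fun i => (p i : ℂ)⁻¹
  have hA0 : ∀ i, p i = 0 → ∀ α, A α i = 0 := by
    intro i hi α
    have h1 := congrFun (congrFun hdiag i) i
    rw [diagonal_apply_eq, hi, mul_apply] at h1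
    simp only [conjTranspose_apply, Complex.star_def, Complex.conj_mul'] at h1
    have h2 : ∑ α, ‖A α i‖ ^ 2 = 0 := by exact_mod_cast h1
    rw [Finset.sum_eq_zero_iff_of_nonneg fun _ _ => by positivity] at h2
    simpa using h2 α (Finset.mem_univ _)
  set P := A * D * Aᴴ with hPdef
  have hPA : P * A = A := by
    rw [hPdef, Matrix.mul_assoc, hdiag, Matrix.mul_assoc, diagonal_mul_diagonal]
    ext α i
    rw [mul_diagonal]
    by_cases hi : p i = 0
    · simp [hA0 i hi]
    · rw [inv_mul_cancel₀ (by exact_mod_cast hi), mul_one]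
  -- Permutations that hit a zero Schmidt coefficient carry no weight, so the inverses of `p` below
  -- do no harm.
  have hq0 : ∀ π s, p (π (ι s)) = 0 → q π = 0 := by
    intro π s h0
    rw [← hqp s, Finset.sum_eq_zero_iff_of_nonneg
      fun π _ => by split_ifs; exacts [hq π, le_rfl]] at h0
    simpa using h0 π (Finset.mem_univ _)
  have hsq : ∀ π, ((√(q π) : ℝ) : ℂ) * (√(q π) : ℝ) = q π := fun π => by
    rw [← Complex.ofReal_mul, Real.mul_self_sqrt (hq π)]
  have hmix : ∀ (s : Fin d) (F : b → ℂ), ∑ π, (q π : ℂ) * F (π (ι s)) = ∑ i, (p i : ℂ) * F i := by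
    intro s F
    simp only [← hqp s, Complex.ofReal_sum, Finset.sum_mul]
    rw [Finset.sum_comm]
    refine Finset.sum_congr rfl fun π _ => ?_
    rw [Finset.sum_eq_single (π (ι s))]
    · simp
    · intro i _ hi
      simp [hi.symm]
    · simp
  -- outcomes: a shift, a phase, and a permutation
  refine isOneTimePad_of_measurement' (C := (Fin d × Fin d) × Equiv.Perm b) (P := P)
    -- Column `j` of `A` has squared norm `p j`. Dividing it by `p j`, not by its square root,
    -- cancels the Schmidt weights on Bob's side and makes his conditional map isometric; averaging
    -- over `q` restores the missing factor in the completeness relation.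
    (f := fun c r => (d : ℂ)⁻¹ * (√(q c.2) : ℝ) * χ c.1.2 r.1 *
      (A r.2 (c.2 (ι (r.1 + c.1.1))) * (p (c.2 (ι (r.1 + c.1.1))) : ℂ)⁻¹))
    (t := fun c => (d : ℂ)⁻¹ * (√(q c.2) : ℝ))
    (w := fun c s β => star (χ c.1.2 s) * star (U β (c.2 (ι (s + c.1.1))))) Ψ
    ?_ ?_ ?_ ?_ ?_ ?_ ?_ ?_ ?_
  · simp only [Fintype.card_prod, Fintype.card_fin, mul_assoc]
    exact Dvd.intro _ rfl
  · simpa using Fintype.card_le_of_embedding ι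
  · have h1 : Dᴴ = D := by
      rw [diagonal_conjTranspose]
      congr 1
      ext i
      simp
    rw [hPdef, conjTranspose_mul (A * D) Aᴴ, conjTranspose_mul A D, h1, conjTranspose_conjTranspose]
    exact (Matrix.mul_assoc A D Aᴴ).symm
  · rw [hPdef, ← Matrix.mul_assoc, ← Matrix.mul_assoc, ← hPdef, hPA]
  · ext ⟨s, α⟩ ⟨s', α'⟩
    have hPapp : P α α' = ∑ i, (p i : ℂ)⁻¹ * (A α i * star (A α' i)) := by
      rw [hPdef, mul_apply]
      refine Finset.sum_congr rfl fun i _ => ?_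
      rw [mul_diagonal, conjTranspose_apply]
      ring
    rw [Matrix.sum_apply, kroneckerMap_apply, one_apply]
    simp only [vecMulVec_apply, Pi.star_apply, Fintype.sum_prod_type]
    calc _ = ∑ x, (∑ z, χ z s * star (χ z s')) * ∑ π, (d : ℂ)⁻¹ ^ 2 * (q π *
            ((A α (π (ι (s + x))) * (p (π (ι (s + x))) : ℂ)⁻¹) *
              star (A α' (π (ι (s' + x))) * (p (π (ι (s' + x))) : ℂ)⁻¹))) := by
          refine Finset.sum_congr rfl fun x _ => ?_
          rw [Finset.sum_mul_sum]
          refine Finset.sum_congr rfl fun z _ => Finset.sum_congr rfl fun π _ => ?_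
          simp only [star_mul', ← hsq, star_inv₀, Complex.star_def, Complex.conj_ofReal,
            Complex.conj_natCast]
          ring
      _ = _ := by
          simp only [hχ']
          by_cases hs : s = s'
          · subst hs
            simp only [if_true, ← Finset.mul_sum]
            -- The mixture replaces `q` by `p`, which turns the two inverse factors into one and
            -- yields `P`. The `d` phases and `d` shifts absorb the prefactor `d⁻²`.
            have h1 : ∀ x, ∑ π, (q π : ℂ) * ((A α (π (ι (s + x))) * (p (π (ι (s + x))) : ℂ)⁻¹) *
                star (A α' (π (ι (s + x))) * (p (π (ι (s + x))) : ℂ)⁻¹)) = P α α' := by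
              intro x
              rw [hmix (s + x) fun i => (A α i * (p i : ℂ)⁻¹) * star (A α' i * (p i : ℂ)⁻¹), hPapp]
              refine Finset.sum_congr rfl fun i _ => ?_
              by_cases hi : p i = 0
              · simp [hi]
              · have : (p i : ℂ) ≠ 0 := by exact_mod_cast hi
                simp only [star_mul', star_inv₀, Complex.star_def, Complex.conj_ofReal]
                field_simp
            simp only [h1, Finset.sum_const, Finset.card_univ, Fintype.card_fin, nsmul_eq_mul]
            field_simp
          · simp [hs]
  · rw [← hAU, ← Matrix.mul_assoc, hPA]
  · simp only [Fintype.sum_prod_type, star_mul', star_inv₀, Complex.star_def, Complex.conj_ofReal,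
      Complex.conj_natCast, Finset.sum_const, Finset.card_univ, Fintype.card_fin,
      Fintype.card_prod, nsmul_eq_mul]
    have h1 : ∑ π, (d : ℂ)⁻¹ * (√(q π) : ℝ) * ((d : ℂ)⁻¹ * (√(q π) : ℝ))
        = (d : ℂ)⁻¹ ^ 2 * ∑ π, (q π : ℂ) := by
      rw [Finset.mul_sum]
      refine Finset.sum_congr rfl fun π _ => ?_
      rw [← hsq]
      ring
    have h2 : ∑ π, (q π : ℂ) = 1 := by exact_mod_cast hq1
    rw [h1, h2]
    push_cast
    field_simp
  · rintro ⟨⟨x, z⟩, π⟩ s s'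
    have h1 := congrFun (congrFun hU (π (ι (s' + x)))) (π (ι (s + x)))
    rw [mul_apply, one_apply] at h1
    simp only [conjTranspose_apply] at h1
    calc _ = χ z s * star (χ z s') *
          ∑ β, star (U β (π (ι (s' + x)))) * U β (π (ι (s + x))) := by
          rw [Finset.mul_sum]
          refine Finset.sum_congr rfl fun β _ => ?_
          simp only [star_mul', star_star]
          ring
      _ = _ := by
          rw [h1]
          by_cases hs : s = s'
          · subst hs
            rw [if_pos rfl, if_pos rfl, hχ, mul_one]
          · have : π (ι (s' + x)) ≠ π (ι (s + x)) := fun h0 =>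
              hs (add_right_cancel (ι.injective (π.injective h0))).symm
            rw [if_neg this, if_neg hs, mul_zero]
  · rintro ⟨⟨x, z⟩, π⟩ s β
    set j := π (ι (s + x)) with hj
    have h1 : ∑ i, star (A i j) * Ψ (i, β) = p j * star (U β j) := by
      have h2 : Aᴴ * coeff Ψ = diagonal (fun i => (p i : ℂ)) * Uᴴ := by
        rw [← hdiag, Matrix.mul_assoc, hAU]
      have h3 := congrFun (congrFun h2 j) β
      rw [diagonal_mul, mul_apply] at h3
      exact h3
    calc _ = (d : ℂ)⁻¹ * (√(q π) : ℝ) * star (χ z s) * (p j : ℂ)⁻¹ *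
          ∑ i, star (A i j) * Ψ (i, β) := by
          rw [Finset.mul_sum]
          refine Finset.sum_congr rfl fun i _ => ?_
          simp only [star_mul', star_inv₀, Complex.star_def, Complex.conj_ofReal,
            Complex.conj_natCast]
          ring
      _ = _ := by
          rw [h1]
          by_cases h0 : p j = 0
          · simp [hq0 π _ h0]
          · have : (p j : ℂ) ≠ 0 := by exact_mod_cast h0
            field_simp

end Sufficiency

end QOTP


theorem theorem1 {a b : Type*} [Fintype a] [DecidableEq a] [Fintype b] [DecidableEq b]
    (d : ℕ) (hd : 1 ≤ d) (Ψ : EuclideanSpace ℂ (a × b)) (hΨ : ‖Ψ‖ = 1) :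
    QOTP.IsOneTimePad d Ψ ↔ Real.logb 2 (d : ℝ) ≤ QOTP.minEntropy (QOTP.marginalA Ψ) := by
  rw [QOTP.logb_le_minEntropy_iff hd Ψ hΨ]
  exact ⟨fun h => h.le hd hΨ, QOTP.isOneTimePad_of_le hd hΨ⟩
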